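/- For $n\ge 2$, a decreasing factorisation of size $n$ is a sequence $(\tau_1,\dots,\tau_{n-1})$ of transpositions $\tau_i=(a_i~b_i)$ of $\{1,\dots,n\}$, with $a_i<b_i$, such that $\tau_{n-1}\circ\cdots\circ\tau_1=(1~2~\cdots~n)$ and $a_1\ge a_2\ge\cdots\ge a_{n-1}$. For each $n\ge 2$, let $(\tau_1,\dots,\tau_{n-1})$ be a decreasing factorisation of size $n$ chosen uniformly at random, with $\tau_i=(a_i~b_i)$ and $a_i<b_i$. Then: 1. For every $n\ge 2$, $\{b_1,\dots,b_{n-1}\}=\{2,3,\dots,n\}$ almost surely. 2. For every $n\ge 2$ and every $k\in\{1,\dots,n-1\}$, $$\mathbb P\bigl(\#\{a_1,\dots,a_{n-1}\}=k\bigr)=\frac{n}{n-1}\binom{n-1}{k}\binom{n-1}{k-1}\binom{2n-2}{n-1}^{-1}.$$ 3. As $n\to\infty$, $$\frac{\#\{a_1,\dots,a_{n-1}\}-n/2}{\sqrt n}$$ converges in distribution to the centred normal distribution $\mathcal N(0,1/8)$ with variance $1/8$. -/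

import Mathlib

open MeasureTheory ProbabilityTheory Filter

namespace CycleFactorisation

/-- Every set of permutations of a finite set is measurable. -/
instance instMeasurableSpacePerm (n : ℕ) : MeasurableSpace (Equiv.Perm (Fin n)) := ⊤

/-- The permutation `σ` is the transposition `(a b)` with `1 ≤ a < b ≤ n`.
The element `i` of `Fin n` stands for the label `i + 1 ∈ {1, …, n}`. -/
def IsTransposition {n : ℕ} (σ : Equiv.Perm (Fin n)) (a b : ℕ) : Prop :=
  a < b ∧ ∃ i j : Fin n, a = (i : ℕ) + 1 ∧ b = (j : ℕ) + 1 ∧ σ = Equiv.swap i j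

/-- A minimal factorisation of size `n`: a sequence `(τ₁, …, τₙ₋₁)` of transpositions with
`τₙ₋₁ ∘ ⋯ ∘ τ₁ = (1 2 … n)`. -/
def IsMinimalFactorisation {n : ℕ} (τ : Fin (n - 1) → Equiv.Perm (Fin n)) : Prop :=
  (∀ i, ∃ a b, IsTransposition (τ i) a b) ∧ (List.ofFn τ).reverse.prod = finRotate n

/-- The decreasing factorisations of size `n`: the minimal factorisations
`((a₁ b₁), …, (aₙ₋₁ bₙ₋₁))`, where `aᵢ < bᵢ`, such that `a₁ ≥ a₂ ≥ ⋯ ≥ aₙ₋₁`. -/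
def decreasingFactorisations (n : ℕ) : Set (Fin (n - 1) → Equiv.Perm (Fin n)) :=
  {τ | IsMinimalFactorisation τ ∧
    ∀ i j, i < j → ∀ a b a' b', IsTransposition (τ i) a b → IsTransposition (τ j) a' b' → a' ≤ a}

/-- The set `{a₁, …, aₙ₋₁}` of the smaller elements of the transpositions `τᵢ = (aᵢ bᵢ)`. -/
def lowerPoints {n : ℕ} (τ : Fin (n - 1) → Equiv.Perm (Fin n)) : Set ℕ :=
  {a | ∃ i b, IsTransposition (τ i) a b}

/-- The set `{b₁, …, bₙ₋₁}` of the larger elements of the transpositions `τᵢ = (aᵢ bᵢ)`. -/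
def upperPoints {n : ℕ} (τ : Fin (n - 1) → Equiv.Perm (Fin n)) : Set ℕ :=
  {b | ∃ i a, IsTransposition (τ i) a b}

end CycleFactorisation

/-!
Read the factors of a decreasing factorisation as pairs `(a, b)` with `a < b`. The smallest label is
moved by the long cycle, so it is the smaller element of some factor, and since the smaller elements
decrease it is so for the last factor, `(l b)`. Multiplying by `(l b)` splits the cycle on `[l, m]`
into the cycles on `[l, b - 1]` and `[b, m]`. The remaining factors are too few to join these two
intervals (`exists_componentLabel`), so each of them lives in one of the intervals; as the smaller
elements decrease, those in `[b, m]` precede those in `[l, b - 1]`, and both groups are again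
decreasing factorisations (`IsDecreasing.decompose`). Iterating, decreasing factorisations of size
`d + 1` correspond to binary trees with `d` nodes (`decreasingFactorisations_eq_image`). Along this
bijection every label but the smallest one appears exactly once as a larger element, and the number
of distinct smaller elements is the number of nodes without a left child
(`card_fst_treePairs`).

The generating series `F` of binary trees counted by nodes (`x`) and left-less nodes (`y`) satisfies
`F = 1 + x (F - 1 + y) F`. Multiplying by powers of `F` gives a recurrence for the coefficients of
`F ^ r`, which the product formula of Lagrange inversion satisfies (`forestCount_succ_succ`); for
`r = 1` these are the Narayana numbers. Dividing by a Catalan number gives the law in the second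
claim.

That law is a product of two binomial coefficients `C(n - 1, k) C(n - 1, k - 1)` over a central
one, so Stirling's formula yields a local limit theorem (`tendsto_choose_mul_sqrt_div_two_pow`,
`tendsto_sqrt_mul_narayanaWeight`): the law, spread out over the cells of a lattice of mesh
`1 / √n`, has a density that converges pointwise to the Gaussian density of variance `1 / 8`.
Fatou's lemma then gives `μ G ≤ liminf μₙ G` for open sets `G`, which is enough for convergence in
distribution by the portmanteau theorem (`gaussianReal_le_liminf`).
-/

namespace CycleFactorisation

open Finset (Icc)

/-! ### Products of transpositions of the natural numbers -/

/-- The map obtained by applying the transpositions `(p.1 p.2)`, for `p` in the list `L`, one after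
the other, the head of the list first. -/
def swapAll : List (ℕ × ℕ) → ℕ → ℕ
  | [], x => x
  | p :: L, x => swapAll L (Equiv.swap p.1 p.2 x)

/-- The cycle `l ↦ l + 1 ↦ ⋯ ↦ m ↦ l` on the interval `[l, m]`, for `l ≤ m`, as a map on `ℕ`. -/
def intervalCycle (l m x : ℕ) : ℕ :=
  if x = m then l else if l ≤ x ∧ x < m then x + 1 else x

/-- The list of pairs `L`, read as a sequence of transpositions, is a decreasing factorisation of
the cycle on the interval `[l, m]`. The equation for the length implies `l ≤ m`. -/
structure IsDecreasing (l m : ℕ) (L : List (ℕ × ℕ)) : Prop where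
  bounds : ∀ p ∈ L, l ≤ p.1 ∧ p.1 < p.2 ∧ p.2 ≤ m
  swapAll_eq : ∀ x, swapAll L x = intervalCycle l m x
  length_eq : l + L.length = m
  sorted : L.Pairwise fun p q => q.1 ≤ p.1

theorem swapAll_append (L M : List (ℕ × ℕ)) (x : ℕ) :
    swapAll (L ++ M) x = swapAll M (swapAll L x) := by
  induction L generalizing x with
  | nil => rfl
  | cons p L ih => exact ih _

theorem swapAll_eq_self {L : List (ℕ × ℕ)} {x : ℕ} (h : ∀ p ∈ L, x ≠ p.1 ∧ x ≠ p.2) :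
    swapAll L x = x := by
  induction L with
  | nil => rfl
  | cons p L ih =>
    have hp := h p (by simp)
    rw [swapAll, Equiv.swap_apply_of_ne_of_ne hp.1 hp.2]
    exact ih fun q hq => h q (by simp [hq])

theorem le_swapAll {L : List (ℕ × ℕ)} {b x : ℕ} (h : ∀ p ∈ L, b ≤ p.1 ∧ b ≤ p.2) (hx : b ≤ x) :
    b ≤ swapAll L x := by
  induction L generalizing x with
  | nil => exact hx
  | cons p L ih =>
    have hp := h p (by simp)
    refine ih (fun q hq => h q (by simp [hq])) ?_
    rw [Equiv.swap_apply_def]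
    split_ifs <;> omega

theorem apply_swapAll {L : List (ℕ × ℕ)} {g : ℕ → ℕ} (h : ∀ p ∈ L, g p.1 = g p.2) (x : ℕ) :
    g (swapAll L x) = g x := by
  induction L generalizing x with
  | nil => rfl
  | cons p L ih =>
    have hp := h p (by simp)
    rw [swapAll, ih fun q hq => h q (by simp [hq]), Equiv.swap_apply_def]
    split_ifs <;> simp_all

/-- A graph with `e` edges has at least `|S| - e` connected components that meet a set `S` of
vertices: the values of `g` label the components. -/
theorem exists_componentLabel (S : Finset ℕ) (L : List (ℕ × ℕ)) :
    ∃ g : ℕ → ℕ, (∀ p ∈ L, g p.1 = g p.2) ∧ S.card ≤ (S.image g).card + L.length := by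
  induction L with
  | nil => exact ⟨id, by simp, by simp⟩
  | cons p L ih =>
    obtain ⟨g, hg, hS⟩ := ih
    -- Merge the components of `p.1` and `p.2`.
    refine ⟨fun x => if g x = g p.1 then g p.2 else g x, ?_, ?_⟩
    · intro q hq
      rcases List.mem_cons.1 hq with rfl | hq
      · simp
      · simp [hg q hq]
    · have hsub : S.image g ⊆
          insert (g p.1) (S.image fun x => if g x = g p.1 then g p.2 else g x) := by
        intro y hy
        obtain ⟨x, hx, rfl⟩ := Finset.mem_image.1 hy
        by_cases hxp : g x = g p.1
        · simp [hxp]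
        · exact Finset.mem_insert_of_mem (Finset.mem_image.2 ⟨x, hx, by simp [hxp]⟩)
      have := (Finset.card_le_card hsub).trans (Finset.card_insert_le _ _)
      simp only [List.length_cons]
      omega

/-- A labelling that is constant along the factors is constant on the cycles of their product. -/
theorem constant_on_interval {L : List (ℕ × ℕ)} {g : ℕ → ℕ} (hg : ∀ p ∈ L, g p.1 = g p.2)
    {l m : ℕ} (h : ∀ x, l ≤ x → x < m → swapAll L x = x + 1) (x : ℕ) (hlx : l ≤ x) (hxm : x ≤ m) :
    g x = g l := by
  induction x, hlx using Nat.le_induction with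
  | base => rfl
  | succ x hx ih =>
    rw [← h x hx (by omega), apply_swapAll hg, ih (by omega)]

/-- A factorisation of a cycle of length `m - l + 1` into transpositions has at least `m - l`
factors. -/
theorem le_add_length {L : List (ℕ × ℕ)} {l m : ℕ} (hlm : l ≤ m)
    (h : ∀ x, l ≤ x → x < m → swapAll L x = x + 1) : m ≤ l + L.length := by
  obtain ⟨g, hg, hS⟩ := exists_componentLabel (Icc l m) L
  have : (Icc l m).image g ⊆ {g l} := by
    intro y hy
    obtain ⟨x, hx, rfl⟩ := Finset.mem_image.1 hy
    rw [Finset.mem_Icc] at hx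
    simp [constant_on_interval hg h x hx.1 hx.2]
  have := Finset.card_le_card this
  simp only [Finset.card_singleton, Nat.card_Icc] at *
  omega

theorem exists_split {L : List (ℕ × ℕ)} (hL : L.Pairwise fun p q => q.1 ≤ p.1) (b : ℕ) :
    ∃ M N, L = M ++ N ∧ (∀ p ∈ M, b ≤ p.1) ∧ ∀ p ∈ N, p.1 < b := by
  induction L with
  | nil => exact ⟨[], [], by simp⟩
  | cons p L ih =>
    rw [List.pairwise_cons] at hL
    obtain ⟨M, N, rfl, hM, hN⟩ := ih hL.2
    by_cases hp : b ≤ p.1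
    · exact ⟨p :: M, N, rfl, by simpa [hp] using hM, hN⟩
    · refine ⟨[], p :: (M ++ N), rfl, by simp, fun q hq => ?_⟩
      rcases List.mem_cons.1 hq with rfl | hq
      · omega
      · have := hL.1 q hq
        omega

/-! ### Decreasing factorisations and binary trees -/

/-- The decreasing factorisation of the cycle on `[l, l + d]` attached to a binary tree with `d`
nodes. If `s` is the left subtree and `t` the right one, the last factor is `(l b)` with
`b = l + 1 + |s|`; it is preceded by the factorisation of the cycle on `[l, b - 1]` attached to `s`,
which is preceded by the factorisation of the cycle on `[b, l + d]` attached to `t`. -/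
def treePairs : ℕ → BinaryTree Unit → List (ℕ × ℕ)
  | _, .nil => []
  | l, .node _ s t =>
    treePairs (l + 1 + s.numNodes) t ++ treePairs l s ++ [(l, l + 1 + s.numNodes)]

theorem length_treePairs (t : BinaryTree Unit) (l : ℕ) :
    (treePairs l t).length = t.numNodes := by
  induction t generalizing l with
  | nil => rfl
  | node _ s t hs ht => simp [treePairs, hs, ht]; omega

theorem swap_intervalCycle_intervalCycle {l b m : ℕ} (hb : l < b) (hm : b ≤ m) (x : ℕ) :
    Equiv.swap l b (intervalCycle l (b - 1) (intervalCycle b m x)) = intervalCycle l m x := by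
  simp only [intervalCycle, Equiv.swap_apply_def]
  split_ifs <;> omega

theorem isDecreasing_treePairs (t : BinaryTree Unit) (l : ℕ) :
    IsDecreasing l (l + t.numNodes) (treePairs l t) := by
  induction t generalizing l with
  | nil =>
    refine ⟨by simp [treePairs], fun x => ?_, by simp [treePairs], by simp [treePairs]⟩
    simp only [treePairs, swapAll, intervalCycle, BinaryTree.numNodes, add_zero]
    split_ifs <;> omega
  | node _ s t hs ht =>
    replace hs := hs l
    replace ht := ht (l + 1 + s.numNodes)
    refine ⟨?_, fun x => ?_, ?_, ?_⟩
    · intro p hp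
      simp only [treePairs, List.mem_append, List.mem_singleton, BinaryTree.numNodes] at hp ⊢
      rcases hp with (hp | hp) | rfl
      · have := ht.bounds p hp
        omega
      · have := hs.bounds p hp
        omega
      · simp only
        omega
    · have h := swap_intervalCycle_intervalCycle (l := l) (b := l + 1 + s.numNodes)
        (m := l + 1 + s.numNodes + t.numNodes) (by omega) (by omega) x
      rw [treePairs, swapAll_append, swapAll_append, ht.swapAll_eq, hs.swapAll_eq]
      rw [show l + 1 + s.numNodes - 1 = l + s.numNodes by omega] at h
      simp only [swapAll, h, BinaryTree.numNodes]
      congr 1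
      omega
    · rw [length_treePairs]
    · simp only [treePairs, List.pairwise_append, hs.sorted, ht.sorted, List.mem_append,
        List.mem_singleton, List.pairwise_singleton, forall_eq, true_and]
      refine ⟨fun p hp q hq => ?_, fun p hp => ?_⟩
      · have := ht.bounds p hp
        have := hs.bounds q hq
        omega
      · rcases hp with hp | hp
        · have := ht.bounds p hp
          omega
        · exact (hs.bounds p hp).1

/-- In a decreasing factorisation of the cycle on `[l, m]`, the last factor has the form `(l b)`,
and removing it splits the rest into decreasing factorisations of the cycles on `[b, m]` and
`[l, b - 1]`. -/
theorem IsDecreasing.decompose {l m : ℕ} {L : List (ℕ × ℕ)} (h : IsDecreasing l m L)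
    (hlm : l < m) :
    ∃ b M N, l < b ∧ b ≤ m ∧ L = M ++ N ++ [(l, b)] ∧ IsDecreasing b m M ∧
      IsDecreasing l (b - 1) N := by
  have hlen := h.length_eq
  obtain rfl | ⟨K, ⟨a, b⟩, rfl⟩ := List.eq_nil_or_concat L
  · simp at hlen
    omega
  rw [List.concat_eq_append] at *
  obtain ⟨hsK, -, hsl⟩ := List.pairwise_append.1 h.sorted
  have hab := h.bounds (a, b) (by simp)
  simp only at hab
  -- The point `l` is moved, so it is the smaller element of some factor.
  obtain rfl : a = l := by
    by_contra hne
    have hfix : swapAll (K ++ [(a, b)]) l = l := by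
      refine swapAll_eq_self fun p hp => ?_
      have hp' := h.bounds p hp
      have : a ≤ p.1 := by
        rcases List.mem_append.1 hp with hp | hp
        · exact hsl p hp (a, b) (by simp)
        · rw [List.mem_singleton.1 hp]
      omega
    rw [h.swapAll_eq, intervalCycle] at hfix
    split_ifs at hfix <;> omega
  have hK : ∀ x, swapAll K x = intervalCycle a (b - 1) (intervalCycle b m x) := by
    intro x
    have := h.swapAll_eq x
    rw [swapAll_append, ← swap_intervalCycle_intervalCycle hab.2.1 hab.2.2] at this
    exact (Equiv.swap a b).injective this
  have hK1 : ∀ x, a ≤ x → x < b - 1 → swapAll K x = x + 1 := by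
    intro x h1 h2
    rw [hK, intervalCycle, intervalCycle]
    split_ifs <;> omega
  have hK2 : ∀ x, b ≤ x → x < m → swapAll K x = x + 1 := by
    intro x h1 h2
    rw [hK, intervalCycle, intervalCycle]
    split_ifs <;> omega
  have hbK : ∀ p ∈ K, a ≤ p.1 ∧ p.1 < p.2 ∧ p.2 ≤ m := fun p hp => h.bounds p (by simp [hp])
  rw [List.length_append, List.length_singleton] at hlen
  -- A factor joining the two intervals would leave only one component, but there are too few
  -- factors for that.
  have hcross : ∀ p ∈ K, p.1 < b → p.2 < b := by
    intro p hp hpb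
    by_contra hpb'
    obtain ⟨g, hg, hS⟩ := exists_componentLabel (Icc a m) K
    have hp3 := hbK p hp
    have hgb : g b = g a := by
      rw [← constant_on_interval hg hK1 p.1 hp3.1 (by omega), hg p hp,
        constant_on_interval hg hK2 p.2 (by omega) hp3.2.2]
    have : (Icc a m).image g ⊆ {g a} := by
      intro y hy
      obtain ⟨x, hx, rfl⟩ := Finset.mem_image.1 hy
      rw [Finset.mem_Icc] at hx
      rw [Finset.mem_singleton]
      by_cases hxb : x < b
      · exact constant_on_interval hg hK1 x hx.1 (by omega)
      · rw [constant_on_interval hg hK2 x (by omega) hx.2, hgb]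
    have := Finset.card_le_card this
    simp only [Finset.card_singleton, Nat.card_Icc] at *
    omega
  obtain ⟨M, N, rfl, hM, hN⟩ := exists_split hsK b
  have hM' : ∀ p ∈ M, b ≤ p.1 ∧ p.1 < p.2 ∧ p.2 ≤ m := fun p hp =>
    ⟨hM p hp, (hbK p (by simp [hp])).2⟩
  have hN' : ∀ p ∈ N, a ≤ p.1 ∧ p.1 < p.2 ∧ p.2 ≤ b - 1 := fun p hp => by
    have h1 := hbK p (by simp [hp])
    have h2 := hcross p (by simp [hp]) (hN p hp)
    omega
  have hMlow : ∀ x < b, swapAll M x = x := fun x hx =>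
    swapAll_eq_self fun p hp => by have := hM' p hp; omega
  have hNhigh : ∀ x, b ≤ x → swapAll N x = x := fun x hx =>
    swapAll_eq_self fun p hp => by have := hN' p hp; omega
  have hMswap : ∀ x, swapAll M x = intervalCycle b m x := by
    intro x
    by_cases hx : x < b
    · rw [hMlow x hx, intervalCycle]
      split_ifs <;> omega
    · have h1 := hK x
      have h2 : b ≤ swapAll M x :=
        le_swapAll (fun p hp => by have := hM' p hp; omega) (by omega)
      rw [swapAll_append, hNhigh _ h2] at h1
      rw [h1]
      simp only [intervalCycle]
      split_ifs <;> omega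
  have hNswap : ∀ x, swapAll N x = intervalCycle a (b - 1) x := by
    intro x
    by_cases hx : x < b
    · have h1 := hK x
      rw [swapAll_append, hMlow x hx] at h1
      rw [h1]
      simp only [intervalCycle]
      split_ifs <;> omega
    · rw [hNhigh x (by omega), intervalCycle]
      split_ifs <;> omega
  obtain ⟨hsM, hsN, -⟩ := List.pairwise_append.1 hsK
  -- Neither part can have fewer factors than its cycle needs, and the total is exact.
  have hlM : m ≤ b + M.length := le_add_length hab.2.2 fun x h1 h2 => by
    rw [hMswap, intervalCycle]
    split_ifs <;> omega
  have hlN : b - 1 ≤ a + N.length := le_add_length (by omega) fun x h1 h2 => by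
    rw [hNswap, intervalCycle]
    split_ifs <;> omega
  rw [List.length_append] at hlen
  exact ⟨b, M, N, hab.2.1, hab.2.2, rfl, ⟨hM', hMswap, by omega, hsM⟩,
    ⟨hN', hNswap, by omega, hsN⟩⟩

theorem IsDecreasing.exists_treePairs_eq {l m : ℕ} {L : List (ℕ × ℕ)} (h : IsDecreasing l m L) :
    ∃ t, treePairs l t = L := by
  induction hd : m - l using Nat.strong_induction_on generalizing l m L with
  | _ d ih =>
    have hlen := h.length_eq
    rcases Nat.eq_zero_or_pos d with rfl | hpos
    · refine ⟨.nil, ?_⟩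
      rw [treePairs, List.eq_nil_of_length_eq_zero (l := L) (by omega)]
    · obtain ⟨b, M, N, hlb, hbm, rfl, hM, hN⟩ := h.decompose (by omega)
      obtain ⟨t, rfl⟩ := ih (m - b) (by omega) hM rfl
      obtain ⟨s, rfl⟩ := ih (b - 1 - l) (by omega) hN rfl
      have hs := hN.length_eq
      rw [length_treePairs] at hs
      refine ⟨.node () s t, ?_⟩
      rw [treePairs, show l + 1 + s.numNodes = b by omega]

theorem treePairs_injective (l : ℕ) : Function.Injective (treePairs l) := by
  intro t t' h
  induction t generalizing l t' with
  | nil =>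
    cases t' with
    | nil => rfl
    | node _ s' t' => simp [treePairs] at h
  | node _ s t hs ht =>
    cases t' with
    | nil => simp [treePairs] at h
    | node _ s' t' =>
      obtain ⟨h1, h2⟩ := List.append_inj' h rfl
      simp only [List.cons.injEq, Prod.mk.injEq, true_and, and_true, add_right_inj] at h2
      rw [h2] at h1
      obtain ⟨h3, h4⟩ := List.append_inj' h1 (by simp [length_treePairs, h2])
      rw [ht _ h3, hs _ h4]

/-- The number of nodes of a binary tree whose left subtree is empty. -/
def leftless : BinaryTree Unit → ℕ
  | .nil => 0
  | .node _ s t => leftless s + leftless t + if s = .nil then 1 else 0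

theorem card_fst_treePairs (t : BinaryTree Unit) (l : ℕ) :
    ((treePairs l t).map Prod.fst).toFinset.card = leftless t := by
  induction t generalizing l with
  | nil => rfl
  | node _ s t hs ht =>
    have hdisj : Disjoint ((treePairs (l + 1 + s.numNodes) t).map Prod.fst).toFinset
        (insert l ((treePairs l s).map Prod.fst).toFinset) := by
      rw [Finset.disjoint_left]
      intro a ha ha'
      simp only [List.mem_toFinset, List.mem_map, Finset.mem_insert] at ha ha'
      obtain ⟨p, hp, rfl⟩ := ha
      have h1 := (isDecreasing_treePairs t _).bounds p hp
      rcases ha' with h2 | ⟨q, hq, h2⟩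
      · omega
      · have h3 := (isDecreasing_treePairs s _).bounds q hq
        omega
    have heq : ((treePairs l (.node () s t)).map Prod.fst).toFinset =
        ((treePairs (l + 1 + s.numNodes) t).map Prod.fst).toFinset ∪
          insert l ((treePairs l s).map Prod.fst).toFinset := by
      ext a
      simp only [treePairs, List.mem_toFinset, List.mem_map, List.mem_append, List.mem_singleton,
        Finset.mem_union, Finset.mem_insert]
      grind
    rw [heq, Finset.card_union_of_disjoint hdisj, ht]
    have hs' := hs l
    cases s with
    | nil => simp [treePairs, leftless, add_comm]
    | node _ s s' =>
      rw [Finset.insert_eq_of_mem (by simp [treePairs]), hs',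
        leftless.eq_2 _ (.node _ s s')]
      simp [add_comm]

theorem mem_snd_treePairs (t : BinaryTree Unit) (l b : ℕ) :
    b ∈ (treePairs l t).map Prod.snd ↔ l < b ∧ b ≤ l + t.numNodes := by
  induction t generalizing l with
  | nil => simp [treePairs]
  | node _ s t hs ht =>
    simp only [treePairs, List.map_append, List.mem_append, hs, ht, List.map_cons, List.map_nil,
      List.mem_singleton, BinaryTree.numNodes]
    omega

/-! ### Counting binary trees by their left-less nodes -/

/-- The generating series `∑ₜ x ^ |t| y ^ (leftless t)` over all binary trees `t`, as a power series
in `x` with coefficients in `ℚ[y]`. -/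
noncomputable def treeSeries : PowerSeries (Polynomial ℚ) :=
  PowerSeries.mk fun d => ∑ t ∈ BinaryTree.treesOfNumNodesEq d, Polynomial.X ^ leftless t

/-- The series `F - 1 + y` counts binary trees `s` by nodes and left-less nodes when `s` is the left
subtree of a further node, which is left-less if `s` is empty. -/
theorem coeff_leftSubtreeSeries (e : ℕ) :
    PowerSeries.coeff e (treeSeries - 1 + PowerSeries.C Polynomial.X) =
      ∑ s ∈ BinaryTree.treesOfNumNodesEq e,
        (Polynomial.X : Polynomial ℚ) ^ (leftless s + if s = .nil then 1 else 0) := by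
  rw [map_add, map_sub, PowerSeries.coeff_one, PowerSeries.coeff_C, treeSeries,
    PowerSeries.coeff_mk]
  rcases Nat.eq_zero_or_pos e with rfl | he
  · simp [leftless]
  · rw [if_neg he.ne', if_neg he.ne', sub_zero, add_zero]
    refine Finset.sum_congr rfl fun s hs => ?_
    rw [BinaryTree.mem_treesOfNumNodesEq] at hs
    rw [if_neg, add_zero]
    rintro rfl
    simp at hs
    omega

/-- Removing the root: the factor `F - 1 + y` accounts for the left subtree, the factor `F` for the
right one. -/
theorem treeSeries_eq :
    treeSeries = 1 + PowerSeries.X *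
      ((treeSeries - 1 + PowerSeries.C Polynomial.X) * treeSeries) := by
  ext1 d
  rcases d with - | d
  · simp [treeSeries, leftless]
  · rw [map_add, PowerSeries.coeff_one, if_neg d.succ_ne_zero, zero_add,
      PowerSeries.coeff_succ_X_mul, PowerSeries.coeff_mul, treeSeries, PowerSeries.coeff_mk,
      BinaryTree.treesOfNumNodesEq_succ, Finset.sum_biUnion]
    · refine Finset.sum_congr rfl fun ij _ => ?_
      rw [← treeSeries, coeff_leftSubtreeSeries, treeSeries, PowerSeries.coeff_mk,
        Finset.sum_mul_sum, BinaryTree.pairwiseNode, Finset.sum_map, Finset.sum_product]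
      refine Finset.sum_congr rfl fun s _ => Finset.sum_congr rfl fun t _ => ?_
      rw [← pow_add]
      change Polynomial.X ^ leftless (.node () s t) = _
      rw [leftless]
      congr 1
      omega
    · intro p _ q _ hpq
      rw [Function.onFun, Finset.disjoint_left]
      intro t hp hq
      refine hpq ?_
      simp only [BinaryTree.pairwiseNode, Finset.mem_map, Finset.mem_product,
        BinaryTree.mem_treesOfNumNodesEq] at hp hq
      obtain ⟨a, ⟨ha1, ha2⟩, rfl⟩ := hp
      obtain ⟨b, ⟨hb1, hb2⟩, hab⟩ := hq
      obtain ⟨-, h1, h2⟩ := BinaryTree.node.inj hab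
      ext
      · rw [← ha1, ← hb1, h1]
      · rw [← ha2, ← hb2, h2]

/-- The coefficient of `x ^ d y ^ k` in the `r`-th power of the generating series of binary trees,
that is, the number of `r`-tuples of trees with `d` nodes in total, `k` of them left-less. -/
noncomputable def forestCount (r d k : ℕ) : ℚ :=
  (PowerSeries.coeff d (treeSeries ^ r)).coeff k

theorem treeSeries_pow_succ (r : ℕ) :
    treeSeries ^ (r + 1) = treeSeries ^ r + PowerSeries.X *
      (treeSeries ^ (r + 2) - treeSeries ^ (r + 1) +
        PowerSeries.C Polynomial.X * treeSeries ^ (r + 1)) := by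
  linear_combination treeSeries ^ r * treeSeries_eq

theorem forestCount_succ_succ_succ (r d k : ℕ) :
    forestCount (r + 1) (d + 1) (k + 1) = forestCount r (d + 1) (k + 1) +
      (forestCount (r + 2) d (k + 1) - forestCount (r + 1) d (k + 1) +
        forestCount (r + 1) d k) := by
  rw [forestCount, treeSeries_pow_succ]
  simp only [map_add, map_sub, PowerSeries.coeff_succ_X_mul, PowerSeries.coeff_C_mul,
    Polynomial.coeff_add, Polynomial.coeff_sub, Polynomial.coeff_X_mul, forestCount]

theorem forestCount_succ_succ_zero (r d : ℕ) :
    forestCount (r + 1) (d + 1) 0 = forestCount r (d + 1) 0 +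
      (forestCount (r + 2) d 0 - forestCount (r + 1) d 0) := by
  rw [forestCount, treeSeries_pow_succ]
  simp only [map_add, map_sub, PowerSeries.coeff_succ_X_mul, PowerSeries.coeff_C_mul,
    Polynomial.coeff_add, Polynomial.coeff_sub, Polynomial.mul_coeff_zero, Polynomial.coeff_X_zero,
    zero_mul, add_zero, forestCount]

theorem forestCount_zero_succ (d k : ℕ) : forestCount 0 (d + 1) k = 0 := by
  simp [forestCount, PowerSeries.coeff_one]

theorem forestCount_zero_right (r k : ℕ) : forestCount r 0 k = if k = 0 then 1 else 0 := by
  have : PowerSeries.coeff 0 (treeSeries ^ r) = 1 := by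
    simp [treeSeries, leftless]
  rw [forestCount, this, Polynomial.coeff_one]

theorem forestCount_succ_zero (r d : ℕ) : forestCount r (d + 1) 0 = 0 := by
  induction d generalizing r with
  | zero =>
    induction r with
    | zero => exact forestCount_zero_succ _ _
    | succ r ih => simp [forestCount_succ_succ_zero, ih, forestCount_zero_right]
  | succ d ihd =>
    induction r with
    | zero => exact forestCount_zero_succ _ _
    | succ r ih => rw [forestCount_succ_succ_zero, ih, ihd, ihd, sub_zero, add_zero]

theorem cast_choose_succ_mul (n k : ℕ) :
    (n.choose (k + 1) : ℚ) * (k + 1) = n.choose k * (n - k) := by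
  rcases le_or_gt k n with h | h
  · have := Nat.choose_succ_right_eq n k
    rw [← Nat.cast_sub h]
    exact_mod_cast this
  · rw [Nat.choose_eq_zero_of_lt h, Nat.choose_eq_zero_of_lt (by omega)]
    simp

/-- The closed form `r / d * C(d, k) * C(d + r - 1, k - 1)`, which Lagrange inversion predicts,
satisfies the recurrence that removing the root of the first tree gives. -/
theorem forestCount_succ_succ (r d k : ℕ) :
    (d + 1) * forestCount r (d + 1) (k + 1) = r * (d + 1).choose (k + 1) * (d + r).choose k := by
  induction d generalizing r k with
  | zero =>
    induction r with
    | zero => simp [forestCount_zero_succ]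
    | succ r ih =>
      rw [forestCount_succ_succ_succ, mul_add, ih]
      rcases k with - | k <;> simp [forestCount_zero_right, Nat.choose_eq_zero_of_lt]
  | succ d ihd =>
    induction r with
    | zero => simp [forestCount_zero_succ]
    | succ r ih =>
      rw [forestCount_succ_succ_succ, mul_add, ih]
      have hd : (d + 1 : ℚ) ≠ 0 := by positivity
      rcases k with - | j
      · have h1 := ihd (r + 2) 0
        have h2 := ihd (r + 1) 0
        rw [forestCount_succ_zero]
        simp only [zero_add, Nat.choose_one_right, Nat.choose_zero_right, Nat.cast_one, mul_one,
          Nat.cast_add] at h1 h2 ⊢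
        refine mul_left_cancel₀ hd ?_
        linear_combination (d + 2 : ℚ) * h1 - (d + 2 : ℚ) * h2
      · have h1 := ihd (r + 2) (j + 1)
        have h2 := ihd (r + 1) (j + 1)
        have h3 := ihd (r + 1) j
        have h4 := cast_choose_succ_mul (d + 1) (j + 1)
        have h5 := cast_choose_succ_mul (d + r + 1) j
        rw [show d + (r + 2) = d + r + 1 + 1 by ring, Nat.choose_succ_succ' (d + r + 1)] at h1
        rw [show d + (r + 1) = d + r + 1 by ring] at h2 h3
        rw [show d + 1 + (r + 1) = d + r + 1 + 1 by ring, show d + 1 + r = d + r + 1 by ring,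
          Nat.choose_succ_succ' (d + r + 1), Nat.choose_succ_succ' (d + 1)]
        push_cast at h1 h2 h3 h4 h5 ⊢
        generalize ((d + 1).choose (j + 1 + 1) : ℚ) = U at *
        generalize ((d + 1).choose (j + 1) : ℚ) = V at *
        generalize ((d + r + 1).choose (j + 1) : ℚ) = S at *
        generalize ((d + r + 1).choose j : ℚ) = T at *
        refine mul_left_cancel₀ hd ?_
        linear_combination (d + 2 : ℚ) * (h1 - h2 + h3) + (S + T) * h4 - (U + V) * h5

/-- The Narayana numbers count the binary trees by their left-less nodes. -/
theorem card_leftless_eq (d k : ℕ) :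
    ((d + 1) * ((BinaryTree.treesOfNumNodesEq (d + 1)).filter (leftless · = k + 1)).card : ℚ) =
      (d + 1).choose (k + 1) * (d + 1).choose k := by
  have h := forestCount_succ_succ 1 d k
  rw [Nat.cast_one, one_mul] at h
  rw [← h, forestCount, pow_one, treeSeries, PowerSeries.coeff_mk, Polynomial.finsetSum_coeff]
  simp [Polynomial.coeff_X_pow, eq_comm]

/-! ### Decreasing factorisations as permutations of `Fin (d + 1)` -/

theorem IsTransposition.unique {n : ℕ} {σ : Equiv.Perm (Fin n)} {a b a' b' : ℕ}
    (h : IsTransposition σ a b) (h' : IsTransposition σ a' b') : a = a' ∧ b = b' := by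
  obtain ⟨hab, i, j, rfl, rfl, rfl⟩ := h
  obtain ⟨hab', i', j', rfl, rfl, heq⟩ := h'
  have hij : i < j := by omega
  have hij' : i' < j' := by omega
  have h1 := congrArg (fun σ : Equiv.Perm (Fin n) => σ i) heq
  have h2 := congrArg (fun σ : Equiv.Perm (Fin n) => σ j) heq
  simp only [Equiv.swap_apply_left, Equiv.swap_apply_right] at h1 h2
  rw [Equiv.swap_apply_def] at h1 h2
  split_ifs at h1 h2 <;> grind

theorem isTransposition_swap {n : ℕ} {i j : Fin n} (h : i < j) :
    IsTransposition (Equiv.swap i j) (i + 1) (j + 1) :=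
  ⟨by omega, i, j, rfl, rfl, rfl⟩

theorem coe_reverse_prod_swap {n : ℕ} (M : List (Fin n × Fin n)) (x : Fin n) :
    ((M.map fun p => Equiv.swap p.1 p.2).reverse.prod x : ℕ) =
      swapAll (M.map fun p => ((p.1 : ℕ), (p.2 : ℕ))) x := by
  induction M generalizing x with
  | nil => rfl
  | cons p M ih =>
    rw [List.map_cons, List.reverse_cons, List.prod_append, List.prod_singleton,
      Equiv.Perm.mul_apply, ih, List.map_cons, swapAll]
    congr 1
    simp only [Equiv.swap_apply_def, Fin.ext_iff]
    split_ifs <;> rfl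

theorem coe_finRotate_eq (d : ℕ) (x : Fin (d + 1)) :
    (finRotate (d + 1) x : ℕ) = intervalCycle 0 d x := by
  rw [coe_finRotate, intervalCycle]
  have := x.is_lt
  simp only [Fin.ext_iff, Fin.val_last]
  split_ifs <;> omega

theorem swap_mem_decreasingFactorisations_iff {d : ℕ} {u v : Fin (d + 1 - 1) → Fin (d + 1)}
    (huv : ∀ i, u i < v i) :
    (fun i => Equiv.swap (u i) (v i)) ∈ decreasingFactorisations (d + 1) ↔
      IsDecreasing 0 d (List.ofFn fun i => ((u i : ℕ), (v i : ℕ))) := by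
  have hprod : ∀ x : Fin (d + 1),
      ((List.ofFn fun i => Equiv.swap (u i) (v i)).reverse.prod x : ℕ) =
        swapAll (List.ofFn fun i => ((u i : ℕ), (v i : ℕ))) x := by
    intro x
    have := coe_reverse_prod_swap (List.ofFn fun i => (u i, v i)) x
    rwa [List.map_ofFn, List.map_ofFn] at this
  have hT : ∀ i a b, IsTransposition (Equiv.swap (u i) (v i)) a b ↔ a = u i + 1 ∧ b = v i + 1 := by
    intro i a b
    constructor
    · exact fun h => h.unique (isTransposition_swap (huv i))
    · rintro ⟨rfl, rfl⟩
      exact isTransposition_swap (huv i)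
  constructor
  · rintro ⟨⟨-, h1⟩, h2⟩
    refine ⟨?_, fun x => ?_, by simp, ?_⟩
    · intro p hp
      obtain ⟨i, rfl⟩ := List.mem_ofFn.1 hp
      exact ⟨Nat.zero_le _, huv i, Nat.lt_succ_iff.1 (v i).is_lt⟩
    · by_cases hx : x < d + 1
      · rw [← hprod ⟨x, hx⟩, h1, coe_finRotate_eq]
      · rw [swapAll_eq_self, intervalCycle]
        · split_ifs <;> omega
        · intro p hp
          obtain ⟨i, rfl⟩ := List.mem_ofFn.1 hp
          exact ⟨fun h => by have := (u i).is_lt; simp only at h; omega,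
            fun h => by have := (v i).is_lt; simp only at h; omega⟩
    · rw [List.pairwise_ofFn]
      intro i j hij
      have := h2 i j hij _ _ _ _ ((hT _ _ _).2 ⟨rfl, rfl⟩) ((hT _ _ _).2 ⟨rfl, rfl⟩)
      simpa using this
  · intro h
    refine ⟨⟨fun i => ⟨_, _, (hT _ _ _).2 ⟨rfl, rfl⟩⟩, ?_⟩, ?_⟩
    · ext x
      rw [hprod, h.swapAll_eq, coe_finRotate_eq]
    · intro i j hij a b a' b' hab hab'
      have h1 := List.pairwise_ofFn.1 h.sorted hij
      rw [hT] at hab hab'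
      simp only at h1
      omega

/-- The decreasing factorisation of `(1 2 … d+1)` attached to a binary tree with `d` nodes. The
values on trees with another number of nodes carry no meaning. -/
def treeFactorisation (d : ℕ) (t : BinaryTree Unit) : Fin (d + 1 - 1) → Equiv.Perm (Fin (d + 1)) :=
  fun i => Equiv.swap (Fin.ofNat (d + 1) ((treePairs 0 t).getD i (0, 0)).1)
    (Fin.ofNat (d + 1) ((treePairs 0 t).getD i (0, 0)).2)

theorem getD_treePairs_bounds {d : ℕ} {t : BinaryTree Unit} (ht : t.numNodes = d)
    (i : Fin (d + 1 - 1)) :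
    ((treePairs 0 t).getD i (0, 0)).1 < ((treePairs 0 t).getD i (0, 0)).2 ∧
      ((treePairs 0 t).getD i (0, 0)).2 < d + 1 := by
  have hi : (i : ℕ) < (treePairs 0 t).length := by
    rw [length_treePairs, ht]
    exact i.is_lt
  rw [List.getD_eq_getElem _ _ hi]
  have := (isDecreasing_treePairs t 0).bounds _ (List.getElem_mem hi)
  omega

theorem ofFn_treePairs {d : ℕ} {t : BinaryTree Unit} (ht : t.numNodes = d) :
    (List.ofFn fun i : Fin (d + 1 - 1) =>
      ((Fin.ofNat (d + 1) ((treePairs 0 t).getD i (0, 0)).1 : ℕ),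
        (Fin.ofNat (d + 1) ((treePairs 0 t).getD i (0, 0)).2 : ℕ))) = treePairs 0 t := by
  refine List.ext_getElem (by simp [length_treePairs, ht]) fun i h1 h2 => ?_
  have h3 : i < d + 1 - 1 := by simpa using h1
  have := getD_treePairs_bounds ht ⟨i, h3⟩
  rw [List.getD_eq_getElem _ _ h2] at this
  rw [List.getElem_ofFn]
  simp only [Fin.val_ofNat]
  rw [List.getD_eq_getElem _ _ h2, Nat.mod_eq_of_lt (by omega), Nat.mod_eq_of_lt (by omega)]

theorem ofNat_getD_lt {d : ℕ} {t : BinaryTree Unit} (ht : t.numNodes = d) (i : Fin (d + 1 - 1)) :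
    Fin.ofNat (d + 1) ((treePairs 0 t).getD i (0, 0)).1 <
      Fin.ofNat (d + 1) ((treePairs 0 t).getD i (0, 0)).2 := by
  have := getD_treePairs_bounds ht i
  rw [Fin.lt_def, Fin.val_ofNat, Fin.val_ofNat, Nat.mod_eq_of_lt (by omega),
    Nat.mod_eq_of_lt (by omega)]
  exact this.1

theorem isTransposition_treeFactorisation_iff {d : ℕ} {t : BinaryTree Unit}
    (ht : t.numNodes = d) (a b : ℕ) :
    (∃ i, IsTransposition (treeFactorisation d t i) a b) ↔
      ∃ p ∈ treePairs 0 t, a = p.1 + 1 ∧ b = p.2 + 1 := by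
  conv_rhs => rw [← ofFn_treePairs ht]
  simp only [List.mem_ofFn, exists_exists_eq_and]
  refine exists_congr fun i => ⟨fun h => h.unique (isTransposition_swap (ofNat_getD_lt ht i)), ?_⟩
  rintro ⟨rfl, rfl⟩
  exact isTransposition_swap (ofNat_getD_lt ht i)

theorem treeFactorisation_injOn (d : ℕ) :
    Set.InjOn (treeFactorisation d) (BinaryTree.treesOfNumNodesEq d) := by
  intro t ht t' ht' h
  rw [Finset.mem_coe, BinaryTree.mem_treesOfNumNodesEq] at ht ht'
  refine treePairs_injective 0 ?_
  rw [← ofFn_treePairs ht, ← ofFn_treePairs ht']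
  congr 1
  funext i
  have h1 := isTransposition_swap (ofNat_getD_lt ht i)
  have h2 := isTransposition_swap (ofNat_getD_lt ht' i)
  have h3 := congrFun h i
  rw [treeFactorisation, treeFactorisation] at h3
  rw [h3] at h1
  have := h1.unique h2
  ext <;> simp only <;> omega

theorem decreasingFactorisations_eq_image (d : ℕ) :
    decreasingFactorisations (d + 1) =
      ((BinaryTree.treesOfNumNodesEq d).image (treeFactorisation d) : Set _) := by
  ext τ
  simp only [Finset.coe_image, Set.mem_image, Finset.mem_coe, BinaryTree.mem_treesOfNumNodesEq]
  constructor
  · intro hτ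
    choose a b hab using hτ.1.1
    choose hlt u v ha hb hswap using hab
    obtain rfl : τ = fun i => Equiv.swap (u i) (v i) := funext hswap
    have huv : ∀ i, u i < v i := fun i => by
      have := hlt i
      rw [ha, hb] at this
      omega
    have hL := (swap_mem_decreasingFactorisations_iff huv).1 hτ
    obtain ⟨t, ht⟩ := hL.exists_treePairs_eq
    have htd : t.numNodes = d := by
      rw [← length_treePairs t 0, ht]
      simp
    refine ⟨t, htd, funext fun i => ?_⟩
    rw [← ofFn_treePairs htd, List.ofFn_inj] at ht
    have hi := congrFun ht i
    simp only [Prod.mk.injEq] at hi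
    rw [treeFactorisation, Fin.ext hi.1, Fin.ext hi.2]
  · rintro ⟨t, ht, rfl⟩
    refine (swap_mem_decreasingFactorisations_iff (ofNat_getD_lt ht)).2 ?_
    rw [ofFn_treePairs ht]
    have := isDecreasing_treePairs t 0
    rwa [ht, zero_add] at this

theorem ncard_lowerPoints_treeFactorisation {d : ℕ} {t : BinaryTree Unit} (ht : t.numNodes = d) :
    (lowerPoints (treeFactorisation d t)).ncard = leftless t := by
  have : lowerPoints (treeFactorisation d t) =
      (fun a => a + 1) '' (((treePairs 0 t).map Prod.fst).toFinset : Set ℕ) := by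
    ext a
    simp only [lowerPoints, Set.mem_ofPred_eq]
    rw [exists_comm]
    simp only [isTransposition_treeFactorisation_iff ht]
    simp
    grind
  rw [this, Set.ncard_image_of_injective _ (add_left_injective 1), Set.ncard_coe_finset,
    card_fst_treePairs]

theorem upperPoints_treeFactorisation {d : ℕ} {t : BinaryTree Unit} (ht : t.numNodes = d) :
    upperPoints (treeFactorisation d t) = Set.Icc 2 (d + 1) := by
  ext b
  simp only [upperPoints, Set.mem_ofPred_eq]
  rw [exists_comm]
  simp only [isTransposition_treeFactorisation_iff ht]
  have h := mem_snd_treePairs t 0 (b - 1)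
  rw [ht, List.mem_map] at h
  rw [Set.mem_Icc]
  constructor
  · rintro ⟨a, p, hp, -, rfl⟩
    have := h.1 ⟨p, hp, rfl⟩
    omega
  · intro hb
    obtain ⟨p, hp, hpb⟩ := h.2 (by omega)
    exact ⟨p.1 + 1, p, hp, rfl, by omega⟩

/-! ### The law of a uniform decreasing factorisation -/

theorem ae_mem_image_treeFactorisation {Ω : Type*} [MeasurableSpace Ω] {P : Measure Ω} (d : ℕ)
    {τ : Ω → Fin (d + 1 - 1) → Equiv.Perm (Fin (d + 1))}
    (hτ : HasLaw τ (uniformOn (decreasingFactorisations (d + 1))) P) :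
    ∀ᵐ ω ∂P, ∃ t : BinaryTree Unit, t.numNodes = d ∧ treeFactorisation d t = τ ω := by
  have h : ∀ᵐ σ ∂uniformOn (decreasingFactorisations (d + 1)),
      σ ∈ decreasingFactorisations (d + 1) := ae_cond_mem (Set.toFinite _).measurableSet
  rw [← hτ.map_eq] at h
  filter_upwards [ae_of_ae_map hτ.aemeasurable h] with ω hω
  simpa [decreasingFactorisations_eq_image] using hω

theorem measureReal_ncard_lowerPoints_eq {Ω : Type*} [MeasurableSpace Ω] {P : Measure Ω} (d : ℕ)
    {τ : Ω → Fin (d + 1 - 1) → Equiv.Perm (Fin (d + 1))}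
    (hτ : HasLaw τ (uniformOn (decreasingFactorisations (d + 1))) P) (k : ℕ) :
    P.real {ω | (lowerPoints (τ ω)).ncard = k} =
      ((BinaryTree.treesOfNumNodesEq d).filter (leftless · = k)).card / catalan d := by
  classical
  have h1 : P.real {ω | (lowerPoints (τ ω)).ncard = k} =
      (uniformOn (decreasingFactorisations (d + 1))).real {σ | (lowerPoints σ).ncard = k} := by
    rw [← hτ.map_eq, map_measureReal_apply_of_aemeasurable hτ.aemeasurable
      (Set.toFinite _).measurableSet]
    rfl
  have h2 : decreasingFactorisations (d + 1) ∩ {σ | (lowerPoints σ).ncard = k} =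
      (((BinaryTree.treesOfNumNodesEq d).filter (leftless · = k)).image (treeFactorisation d) :
        Set _) := by
    ext σ
    simp only [decreasingFactorisations_eq_image, Finset.coe_image, Set.mem_inter_iff,
      Set.mem_image, Finset.mem_coe, Finset.mem_filter, BinaryTree.mem_treesOfNumNodesEq,
      Set.mem_ofPred_eq]
    constructor
    · rintro ⟨⟨t, ht, rfl⟩, hk⟩
      exact ⟨t, ⟨ht, (ncard_lowerPoints_treeFactorisation ht).symm.trans hk⟩, rfl⟩
    · rintro ⟨t, ⟨ht, hk⟩, rfl⟩
      exact ⟨⟨t, ht, rfl⟩, (ncard_lowerPoints_treeFactorisation ht).trans hk⟩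
  have hcard1 := Finset.card_image_of_injOn (treeFactorisation_injOn d)
  have hcard2 := Finset.card_image_of_injOn ((treeFactorisation_injOn d).mono
    (Finset.coe_subset.2 (Finset.filter_subset (leftless · = k) _)))
  rw [h1, measureReal_def, ← uniformOn_inter_self (Set.toFinite _), h2,
    decreasingFactorisations_eq_image, uniformOn_apply_finset,
    Finset.inter_eq_right.2 (Finset.image_subset_image (Finset.filter_subset _ _)), hcard1, hcard2,
    BinaryTree.treesOfNumNodesEq_card_eq_catalan]
  simp

/-- The Narayana distribution; for `k ≥ n` both sides vanish. -/
theorem measureReal_ncard_lowerPoints_eq_choose {Ω : Type*} [MeasurableSpace Ω] {P : Measure Ω}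
    {n : ℕ} (hn : 2 ≤ n) {τ : Ω → Fin (n - 1) → Equiv.Perm (Fin n)}
    (hτ : HasLaw τ (uniformOn (decreasingFactorisations n)) P) {k : ℕ} (hk : 1 ≤ k) :
    P.real {ω | (lowerPoints (τ ω)).ncard = k} =
      (n : ℝ) / ((n : ℝ) - 1) * ((n - 1).choose k : ℝ) * ((n - 1).choose (k - 1) : ℝ) /
        ((2 * n - 2).choose (n - 1) : ℝ) := by
  obtain ⟨d, rfl⟩ : ∃ d, n = d + 1 + 1 := ⟨n - 2, by omega⟩
  obtain ⟨k, rfl⟩ : ∃ j, k = j + 1 := ⟨k - 1, by omega⟩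
  rw [measureReal_ncard_lowerPoints_eq (d + 1) hτ]
  have h1 : ((d + 1) *
      ((BinaryTree.treesOfNumNodesEq (d + 1)).filter (leftless · = k + 1)).card : ℝ) = (d + 1).choose (k + 1) * (d + 1).choose k := by
    exact_mod_cast card_leftless_eq d k
  have h2 : ((d + 1 + 1) * catalan (d + 1) : ℝ) = (2 * (d + 1)).choose (d + 1) := by
    exact_mod_cast succ_mul_catalan_eq_centralBinom (d + 1)
  have h3 : 0 < catalan (d + 1) := by
    have := succ_mul_catalan_eq_centralBinom (d + 1)
    have := Nat.centralBinom_pos (d + 1)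
    exact Nat.pos_of_ne_zero fun h => by simp_all
  rw [show 2 * (d + 1 + 1) - 2 = 2 * (d + 1) by omega, Nat.add_sub_cancel, Nat.add_sub_cancel,
    ← h2]
  push_cast
  field_simp
  rw [add_sub_cancel_right]
  linear_combination h1

open Topology Real

/-! ### A local limit theorem for binomial coefficients -/

theorem factorial_eq_stirlingSeq {n : ℕ} (hn : 0 < n) :
    (n.factorial : ℝ) = Stirling.stirlingSeq n * √(2 * n) * exp (n * (log n - 1)) := by
  have hn' : (0 : ℝ) < n := by exact_mod_cast hn
  have h : exp (n * (log n - 1)) = (n / exp 1) ^ n := by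
    rw [mul_comm, ← rpow_natCast, rpow_def_of_pos (by positivity), log_div hn'.ne' (exp_ne_zero _),
      log_exp]
  rw [h, Stirling.stirlingSeq]
  field_simp

/-- Stirling's formula for a binomial coefficient, in terms of `w = (2 k - m) / m`. -/
theorem choose_mul_sqrt_div_two_pow {m k : ℕ} (hk : 0 < k) (hkm : k < m) {w : ℝ}
    (hw : w = (2 * k - m) / m) :
    (m.choose k : ℝ) * √m / 2 ^ m =
      Stirling.stirlingSeq m / (Stirling.stirlingSeq k * Stirling.stirlingSeq (m - k)) *
        √(2 / ((1 + w) * (1 - w))) *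
        exp (-(m / 2 * ((1 + w) * log (1 + w) + (1 - w) * log (1 - w)))) := by
  have hm : (0 : ℝ) < m := by exact_mod_cast hk.trans hkm
  have hk' : (0 : ℝ) < k := by exact_mod_cast hk
  have hl : 0 < m - k := by omega
  have hl' : (0 : ℝ) < (m - k : ℕ) := by exact_mod_cast hl
  have hsum : (m : ℝ) = k + (m - k : ℕ) := by
    exact_mod_cast (Nat.add_sub_cancel' hkm.le).symm
  rw [Nat.cast_choose ℝ hkm.le, factorial_eq_stirlingSeq (hk.trans hkm),
    factorial_eq_stirlingSeq hk, factorial_eq_stirlingSeq hl]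
  have hsk : Stirling.stirlingSeq k ≠ 0 := by
    obtain ⟨j, rfl⟩ := Nat.exists_eq_succ_of_ne_zero hk.ne'
    exact (Stirling.stirlingSeq'_pos j).ne'
  have hsl : Stirling.stirlingSeq (m - k) ≠ 0 := by
    obtain ⟨j, hj⟩ := Nat.exists_eq_succ_of_ne_zero hl.ne'
    rw [hj]
    exact (Stirling.stirlingSeq'_pos j).ne'
  generalize Stirling.stirlingSeq k = sk at *
  generalize Stirling.stirlingSeq (m - k) = sl at *
  generalize Stirling.stirlingSeq m = sm
  generalize ((m - k : ℕ) : ℝ) = l at *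
  have h1 : 1 + w = 2 * k / m := by
    rw [hw]
    field_simp
    ring
  have h2 : 1 - w = 2 * l / m := by
    rw [hw]
    field_simp
    linarith
  have hroot : √(2 / ((1 + w) * (1 - w))) = √(2 * m) * √m / (√(2 * k) * √(2 * l)) := by
    rw [← sqrt_mul (by positivity), ← sqrt_mul (by positivity), ← sqrt_div (by positivity), h1, h2]
    congr 1
    field_simp
  have hexp : exp (-(m / 2 * ((1 + w) * log (1 + w) + (1 - w) * log (1 - w)))) =
      exp (m * (log m - 1)) / (exp (k * (log k - 1)) * exp (l * (log l - 1)) * 2 ^ m) := by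
    have h2m : (2 : ℝ) ^ m = exp (m * log 2) := by
      rw [mul_comm, ← rpow_natCast, rpow_def_of_pos (by positivity)]
    rw [h2m, ← exp_add, ← exp_add, ← exp_sub, h1, h2, log_div (by positivity) hm.ne',
      log_div (by positivity) hm.ne', log_mul (by positivity) hk'.ne',
      log_mul (by positivity) hl'.ne']
    congr 1
    field_simp
    rw [hsum]
    ring
  rw [hroot, hexp]
  field_simp

/-- The cubic terms of the two logarithms are the only error, since
`(1 + w) (w - w ^ 2 / 2) + (1 - w) (-w - w ^ 2 / 2) = w ^ 2`. -/
theorem abs_entropy_sub_sq_le {w : ℝ} (hw : |w| ≤ 1 / 2) :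
    |(1 + w) * log (1 + w) + (1 - w) * log (1 - w) - w ^ 2| ≤ 4 * |w| ^ 3 := by
  have key : ∀ x : ℝ, |x| ≤ 1 / 2 → |x + x ^ 2 / 2 + log (1 - x)| ≤ 2 * |x| ^ 3 := by
    intro x hx
    have h := abs_log_sub_add_sum_range_le (x := x) (by linarith) 2
    have h2 : |x| ^ 3 / (1 - |x|) ≤ 2 * |x| ^ 3 := by
      rw [div_le_iff₀ (by linarith)]
      nlinarith [pow_nonneg (abs_nonneg x) 3]
    simp only [Finset.sum_range_succ, Finset.sum_range_zero] at h
    norm_num at h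
    linarith
  have h1 := key w hw
  have h2 := key (-w) (by rwa [abs_neg])
  rw [abs_neg, sub_neg_eq_add] at h2
  have hw1 := abs_le.1 hw
  have h3 : |(1 - w) * (w + w ^ 2 / 2 + log (1 - w))| ≤ (1 - w) * (2 * |w| ^ 3) := by
    rw [abs_mul, abs_of_pos (by linarith : 0 < 1 - w)]
    exact mul_le_mul_of_nonneg_left h1 (by linarith)
  have h4 : |(1 + w) * (-w + (-w) ^ 2 / 2 + log (1 + w))| ≤ (1 + w) * (2 * |w| ^ 3) := by
    rw [abs_mul, abs_of_pos (by linarith : 0 < 1 + w)]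
    exact mul_le_mul_of_nonneg_left h2 (by linarith)
  calc |(1 + w) * log (1 + w) + (1 - w) * log (1 - w) - w ^ 2|
      = |(1 - w) * (w + w ^ 2 / 2 + log (1 - w)) +
          (1 + w) * (-w + (-w) ^ 2 / 2 + log (1 + w))| := by ring_nf
    _ ≤ (1 - w) * (2 * |w| ^ 3) + (1 + w) * (2 * |w| ^ 3) :=
        (abs_add_le _ _).trans (add_le_add h3 h4)
    _ = 4 * |w| ^ 3 := by ring

/-- The de Moivre–Laplace local limit theorem for the symmetric binomial distribution. -/
theorem tendsto_choose_mul_sqrt_div_two_pow {ι : Type*} {F : Filter ι} {m k : ι → ℕ} {z : ℝ}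
    (hm : Tendsto m F atTop)
    (hk : Tendsto (fun i => (2 * (k i : ℝ) - m i) / √(m i)) F (𝓝 z)) :
    Tendsto (fun i => ((m i).choose (k i) : ℝ) * √(m i) / 2 ^ m i) F
      (𝓝 (√(2 / π) * exp (-(z ^ 2 / 2)))) := by
  set w : ι → ℝ := fun i => (2 * (k i : ℝ) - m i) / m i with hw
  have hmR : Tendsto (fun i => (m i : ℝ)) F atTop := tendsto_natCast_atTop_atTop.comp hm
  have hsq : Tendsto (fun i => √(m i)) F atTop := tendsto_sqrt_atTop.comp hmR
  have hmpos : ∀ᶠ i in F, (0 : ℝ) < m i := hmR.eventually_gt_atTop 0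
  have hw0 : Tendsto w F (𝓝 0) := by
    have := hk.mul hsq.inv_tendsto_atTop
    rw [mul_zero] at this
    refine this.congr fun i => ?_
    simp only [hw, Pi.inv_apply]
    rw [← div_eq_mul_inv, div_div, mul_self_sqrt (Nat.cast_nonneg _)]
  have hmw : Tendsto (fun i => m i * w i ^ 2) F (𝓝 (z ^ 2)) := by
    refine (hk.pow 2).congr' ?_
    filter_upwards [hmpos] with i hi
    simp only [hw]
    rw [div_pow, div_pow, sq_sqrt hi.le]
    field_simp
  have hwsmall : ∀ᶠ i in F, |w i| ≤ 1 / 2 := by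
    have := hw0.abs
    rw [abs_zero] at this
    exact this.eventually_le_const (by norm_num)
  have hexpo : Tendsto (fun i => (m i : ℝ) / 2 *
      ((1 + w i) * log (1 + w i) + (1 - w i) * log (1 - w i))) F (𝓝 (z ^ 2 / 2)) := by
    have herr : Tendsto (fun i => 2 * (m i * w i ^ 2) * |w i|) F (𝓝 0) := by
      simpa using (hmw.const_mul 2).mul hw0.abs
    have hdiff : Tendsto (fun i => (m i : ℝ) / 2 *
        ((1 + w i) * log (1 + w i) + (1 - w i) * log (1 - w i)) - m i * w i ^ 2 / 2) F (𝓝 0) := by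
      refine squeeze_zero_norm' ?_ herr
      filter_upwards [hwsmall, hmpos] with i hi hmi
      have h := abs_entropy_sub_sq_le hi
      rw [norm_eq_abs, show (m i : ℝ) / 2 *
        ((1 + w i) * log (1 + w i) + (1 - w i) * log (1 - w i)) - m i * w i ^ 2 / 2 = m i / 2 *
        ((1 + w i) * log (1 + w i) + (1 - w i) * log (1 - w i) - w i ^ 2) by ring, abs_mul,
        abs_of_pos (by positivity)]
      calc _ ≤ (m i : ℝ) / 2 * (4 * |w i| ^ 3) := mul_le_mul_of_nonneg_left h (by positivity)
        _ = 2 * (m i * w i ^ 2) * |w i| := by rw [← sq_abs (w i)]; ring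
    have := hdiff.add (hmw.div_const 2)
    rw [zero_add] at this
    exact this.congr fun i => by ring
  have hkeq : ∀ᶠ i in F, (k i : ℝ) = m i * ((1 + w i) / 2) := by
    filter_upwards [hmpos] with i hi
    simp only [hw]
    field_simp
    ring
  have hleq : ∀ᶠ i in F, (m i : ℝ) - k i = m i * ((1 - w i) / 2) := by
    filter_upwards [hmpos] with i hi
    simp only [hw]
    field_simp
    ring
  have hkpos : ∀ᶠ i in F, 0 < k i ∧ k i < m i := by
    filter_upwards [hkeq, hleq, hwsmall, hmpos] with i h1 h2 h3 h4
    have h5 := abs_le.1 h3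
    have h6 : (0 : ℝ) < k i := by
      rw [h1]
      exact mul_pos h4 (by linarith)
    have h7 : (0 : ℝ) < m i - k i := by
      rw [h2]
      exact mul_pos h4 (by linarith)
    exact ⟨by exact_mod_cast h6, by exact_mod_cast sub_pos.1 h7⟩
  have hktop : Tendsto k F atTop := by
    rw [← tendsto_natCast_atTop_iff (R := ℝ)]
    refine (hmR.atTop_mul_pos (C := (1 + 0) / 2) (by norm_num)
      ((hw0.const_add 1).div_const 2)).congr' ?_
    filter_upwards [hkeq] with i hi using hi.symm
  have hltop : Tendsto (fun i => m i - k i) F atTop := by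
    rw [← tendsto_natCast_atTop_iff (R := ℝ)]
    refine (hmR.atTop_mul_pos (C := (1 - 0) / 2) (by norm_num)
      ((hw0.const_sub 1).div_const 2)).congr' ?_
    filter_upwards [hleq, hkpos] with i hi hki
    rw [← hi, Nat.cast_sub hki.2.le]
  have hS := Stirling.tendsto_stirlingSeq_sqrt_pi
  have hpi : √π ≠ 0 := (sqrt_pos.2 pi_pos).ne'
  have h1 := (hS.comp hm).div ((hS.comp hktop).mul (hS.comp hltop)) (mul_ne_zero hpi hpi)
  have h2 : Tendsto (fun i => √(2 / ((1 + w i) * (1 - w i)))) F (𝓝 √(2 / ((1 + 0) * (1 - 0)))) :=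
    (tendsto_const_nhds.div ((hw0.const_add 1).mul (hw0.const_sub 1)) (by norm_num)).sqrt
  have h3 := hexpo.neg.rexp
  have h4 := (h1.mul h2).mul h3
  have hlim : √π / (√π * √π) * √(2 / ((1 + 0) * (1 - 0))) = √(2 / π) := by
    rw [sqrt_div (by norm_num) π, show (2 / ((1 + 0) * (1 - 0)) : ℝ) = 2 by norm_num]
    field_simp
  rw [hlim] at h4
  refine h4.congr' ?_
  filter_upwards [hkpos] with i hi
  rw [choose_mul_sqrt_div_two_pow hi.1 hi.2 rfl]
  rfl

open scoped ENNReal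

/-- The probability that a uniform decreasing factorisation of size `n` has `k` distinct smaller
elements; it is zero for `k = 0`. -/
noncomputable def narayanaWeight (n k : ℕ) : ℝ :=
  if k = 0 then 0 else
    (n : ℝ) / ((n : ℝ) - 1) * ((n - 1).choose k : ℝ) * ((n - 1).choose (k - 1) : ℝ) /
      ((2 * n - 2).choose (n - 1) : ℝ)

theorem tendsto_floor_sub_half_div_sqrt (x : ℝ) :
    Tendsto (fun n : ℕ => ((⌊(n : ℝ) / 2 + x * √(n : ℝ)⌋₊ : ℝ) - n / 2) / √(n : ℝ)) atTop
      (𝓝 x) := by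
  have hsq : Tendsto (fun n : ℕ => √(n : ℝ)) atTop atTop :=
    tendsto_sqrt_atTop.comp tendsto_natCast_atTop_atTop
  rw [← tendsto_sub_nhds_zero_iff]
  refine squeeze_zero_norm' ?_ hsq.inv_tendsto_atTop
  filter_upwards [hsq.eventually_gt_atTop (2 * |x|)] with n hn
  have hpos : 0 < √(n : ℝ) := (by positivity : 0 ≤ 2 * |x|).trans_lt hn
  have h0 : 0 ≤ (n : ℝ) / 2 + x * √(n : ℝ) := by
    have h1 := mul_self_sqrt (Nat.cast_nonneg (α := ℝ) n)
    have h2 := neg_abs_le x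
    nlinarith
  have h1 := Nat.floor_le h0
  have h2 := Nat.lt_floor_add_one ((n : ℝ) / 2 + x * √(n : ℝ))
  rw [norm_eq_abs, div_sub' hpos.ne', abs_div, abs_of_pos hpos, Pi.inv_apply, div_eq_mul_inv]
  refine mul_le_of_le_one_left (inv_nonneg.2 hpos.le) ?_
  rw [abs_le]
  constructor <;> linarith

theorem tendsto_two_mul_floor_sub_div_sqrt (x : ℝ) :
    Tendsto (fun m : ℕ => (2 * (⌊((m + 1 : ℕ) : ℝ) / 2 + x * √(m + 1 : ℕ)⌋₊ : ℝ) - m) / √m) atTop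
      (𝓝 (2 * x)) := by
  have hsq : Tendsto (fun m : ℕ => √(m : ℝ)) atTop atTop :=
    tendsto_sqrt_atTop.comp tendsto_natCast_atTop_atTop
  have hratio : Tendsto (fun m : ℕ => √(1 + 1 / (m : ℝ))) atTop (𝓝 √(1 + 0)) :=
    (tendsto_one_div_atTop_nhds_zero_nat.const_add 1).sqrt
  have hmain := ((((tendsto_floor_sub_half_div_sqrt x).comp (tendsto_add_atTop_nat 1)).mul
    hratio).const_mul 2).add hsq.inv_tendsto_atTop
  simp only [add_zero, sqrt_one, mul_one] at hmain
  refine hmain.congr' ?_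
  filter_upwards [eventually_gt_atTop 0] with m hm
  have hm' : (0 : ℝ) < m := by exact_mod_cast hm
  have h1 : √(1 + 1 / (m : ℝ)) = √((m + 1 : ℕ) : ℝ) / √m := by
    rw [← sqrt_div (by positivity)]
    congr 1
    push_cast
    field_simp
  have h2 : 0 < √((m + 1 : ℕ) : ℝ) := sqrt_pos.2 (by positivity)
  have h3 : 0 < √(m : ℝ) := sqrt_pos.2 hm'
  rw [h1, Function.comp_apply, Pi.inv_apply]
  field_simp
  push_cast
  ring

/-- The local limit theorem for the number of distinct smaller elements. -/
theorem tendsto_sqrt_mul_narayanaWeight (x : ℝ) :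
    Tendsto (fun n : ℕ => √(n : ℝ) * narayanaWeight n ⌊(n : ℝ) / 2 + x * √(n : ℝ)⌋₊) atTop
      (𝓝 (gaussianPDFReal 0 (1 / 8) x)) := by
  rw [← tendsto_add_atTop_iff_nat 1]
  set k : ℕ → ℕ := fun m => ⌊((m + 1 : ℕ) : ℝ) / 2 + x * √(m + 1 : ℕ)⌋₊ with hk
  have hk1 : Tendsto (fun m : ℕ => (2 * (k m : ℝ) - m) / √m) atTop (𝓝 (2 * x)) :=
    tendsto_two_mul_floor_sub_div_sqrt x
  have hmR : Tendsto (fun m : ℕ => (m : ℝ)) atTop atTop := tendsto_natCast_atTop_atTop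
  have hsq : Tendsto (fun m : ℕ => √(m : ℝ)) atTop atTop := tendsto_sqrt_atTop.comp hmR
  have hkpos : ∀ᶠ m in atTop, k m ≠ 0 := by
    filter_upwards [hk1.eventually_const_lt (show 2 * x - 1 < 2 * x by linarith),
      hsq.eventually_gt_atTop (|2 * x - 1|)] with m h1 h2 h0
    have h3 : (0 : ℝ) < √m := (abs_nonneg _).trans_lt h2
    rw [h0, lt_div_iff₀ h3] at h1
    have h4 := mul_self_sqrt (Nat.cast_nonneg (α := ℝ) m)
    have h5 := neg_abs_le (2 * x - 1)
    push_cast at h1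
    nlinarith
  have hk2 : Tendsto (fun m : ℕ => (2 * ((k m - 1 : ℕ) : ℝ) - m) / √m) atTop (𝓝 (2 * x)) := by
    have := hk1.sub (hsq.inv_tendsto_atTop.const_mul 2)
    rw [mul_zero, sub_zero] at this
    refine this.congr' ?_
    filter_upwards [hkpos] with m hm
    rw [Nat.cast_sub (Nat.one_le_iff_ne_zero.2 hm), Pi.inv_apply]
    push_cast
    ring
  have hA := tendsto_choose_mul_sqrt_div_two_pow tendsto_id hk1
  have hB := tendsto_choose_mul_sqrt_div_two_pow tendsto_id hk2
  have hC : Tendsto (fun m : ℕ => ((2 * m).choose m : ℝ) * √((2 * m : ℕ) : ℝ) / 2 ^ (2 * m)) atTop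
      (𝓝 (√(2 / π) * exp (-((0 : ℝ) ^ 2 / 2)))) :=
    tendsto_choose_mul_sqrt_div_two_pow (tendsto_id.const_mul_atTop' two_pos) (by simp)
  have hpi : √(2 / π) ≠ 0 := (sqrt_pos.2 (div_pos two_pos pi_pos)).ne'
  have hratio : Tendsto (fun m : ℕ => 1 + 1 / (m : ℝ)) atTop (𝓝 (1 + 0)) :=
    tendsto_one_div_atTop_nhds_zero_nat.const_add 1
  have hmain := (((hratio.mul hratio.sqrt).mul_const √2).mul (hA.mul hB)).div hC
    (mul_ne_zero hpi (exp_ne_zero _))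
  have hlim : (1 + 0) * √(1 + 0) * √2 * (√(2 / π) * exp (-((2 * x) ^ 2 / 2)) *
      (√(2 / π) * exp (-((2 * x) ^ 2 / 2)))) / (√(2 / π) * exp (-((0 : ℝ) ^ 2 / 2))) =
      gaussianPDFReal 0 (1 / 8) x := by
    have h1 : √(2 * π * (1 / 8 : NNReal)) = √π / 2 := by
      rw [show 2 * π * ((1 / 8 : NNReal) : ℝ) = π / 2 ^ 2 by push_cast; ring,
        sqrt_div pi_pos.le, sqrt_sq two_pos.le]
    have h2 : exp (-((2 * x) ^ 2 / 2)) * exp (-((2 * x) ^ 2 / 2)) =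
        exp (-(x - 0) ^ 2 / (2 * (1 / 8 : NNReal))) := by
      rw [← exp_add]
      congr 1
      push_cast
      ring
    rw [gaussianPDFReal, h1, ← h2, sqrt_div two_pos.le]
    have h3 : √2 * √2 = 2 := mul_self_sqrt two_pos.le
    simp only [add_zero, sqrt_one, ne_eq, OfNat.ofNat_ne_zero, not_false_eq_true, zero_pow,
      zero_div, neg_zero, exp_zero]
    field_simp
    linear_combination h3
  rw [hlim] at hmain
  refine hmain.congr' ?_
  filter_upwards [hkpos, eventually_gt_atTop 0] with m hm hm0
  have hm' : (0 : ℝ) < m := by exact_mod_cast hm0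
  have hch : (0 : ℝ) < (2 * m).choose m := by
    exact_mod_cast Nat.choose_pos (by omega)
  have hs : (0 : ℝ) < √m := sqrt_pos.2 hm'
  have h1 : √(1 + 1 / (m : ℝ)) = √((m : ℝ) + 1) / √m := by
    rw [← sqrt_div (by positivity)]
    congr 1
    field_simp
  have h2 : √((2 * m : ℕ) : ℝ) = √2 * √m := by
    rw [Nat.cast_mul, sqrt_mul (by positivity), Nat.cast_ofNat]
  change _ = √((m + 1 : ℕ) : ℝ) * narayanaWeight (m + 1) (k m)
  rw [narayanaWeight, if_neg hm, show 2 * (m + 1) - 2 = 2 * m by omega, Nat.add_sub_cancel]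
  simp only [Pi.div_apply, id, h1, h2, pow_mul']
  push_cast
  rw [add_sub_cancel_right]
  field_simp

/-! ### From the local limit to convergence in distribution -/

/-- Spreading the mass `h k` over the interval of length `1 / s` on which `⌊c + x * s⌋₊ = k` keeps
the total mass. The condition `h 0 = 0` is needed as `⌊·⌋₊` vanishes on all negative numbers, and
only an inequality holds for `s = 0`. -/
theorem lintegral_floor_le {s : ℝ} (hs : 0 ≤ s) (c : ℝ) (h : ℕ → ℝ≥0∞) (h0 : h 0 = 0) :
    ∫⁻ x, ENNReal.ofReal s * h ⌊c + x * s⌋₊ ≤ ∑' k, h k := by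
  rcases hs.eq_or_lt with rfl | hs
  · simp
  have hmeas : Measurable fun x : ℝ => ⌊c + x * s⌋₊ := by fun_prop
  have hcomp : Measurable fun x : ℝ => h ⌊c + x * s⌋₊ :=
    (Measurable.of_discrete (f := h)).comp hmeas
  rw [lintegral_const_mul _ hcomp, ← lintegral_map (f := h) .of_discrete hmeas,
    lintegral_countable', ← ENNReal.tsum_mul_left]
  refine ENNReal.tsum_le_tsum fun k => ?_
  rcases Nat.eq_zero_or_pos k with rfl | hk
  · simp [h0]
  have hpre : (fun x : ℝ => ⌊c + x * s⌋₊) ⁻¹' {k} = Set.Ico ((k - c) / s) ((k + 1 - c) / s) := by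
    ext x
    rw [Set.mem_preimage, Set.mem_singleton_iff, Nat.floor_eq_iff' hk.ne', Set.mem_Ico,
      div_le_iff₀ hs, lt_div_iff₀ hs]
    constructor <;> rintro ⟨h1, h2⟩ <;> constructor <;> linarith
  rw [Measure.map_apply hmeas (measurableSet_singleton k), hpre, Real.volume_Ico,
    show (k + 1 - c) / s - (k - c) / s = 1 / s by ring, mul_comm (h k), ← mul_assoc,
    ← ENNReal.ofReal_mul hs.le, mul_one_div_cancel hs.ne', ENNReal.ofReal_one, one_mul]

/-- A local limit theorem for the weights `q n` on the lattice implies the lower bound for open sets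
in the portmanteau theorem, by Fatou's lemma. -/
theorem gaussianReal_le_liminf {v : NNReal} (hv : v ≠ 0) {q : ℕ → ℕ → ℝ} (hq0 : ∀ n, q n 0 = 0)
    (hq : ∀ x, Tendsto (fun n : ℕ => √(n : ℝ) * q n ⌊(n : ℝ) / 2 + x * √(n : ℝ)⌋₊) atTop
      (𝓝 (gaussianPDFReal 0 v x))) {G : Set ℝ} (hG : IsOpen G) :
    gaussianReal 0 v G ≤ liminf (fun n : ℕ => ∑' k : ℕ,
      (G.indicator 1 (((k : ℝ) - n / 2) / √(n : ℝ)) * ENNReal.ofReal (q n k) : ℝ≥0∞)) atTop := by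
  set h : ℕ → ℕ → ℝ≥0∞ := fun n k =>
    G.indicator 1 (((k : ℝ) - n / 2) / √(n : ℝ)) * ENNReal.ofReal (q n k) with hh
  set f : ℕ → ℝ → ℝ≥0∞ := fun n x =>
    ENNReal.ofReal √(n : ℝ) * h n ⌊(n : ℝ) / 2 + x * √(n : ℝ)⌋₊ with hf
  have hfm : ∀ n, Measurable (f n) := fun n =>
    ((Measurable.of_discrete (f := h n)).comp (by fun_prop)).const_mul _
  calc gaussianReal 0 v G = ∫⁻ x, G.indicator (gaussianPDF 0 v) x := by
        rw [gaussianReal_apply 0 hv, lintegral_indicator hG.measurableSet]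
    _ ≤ ∫⁻ x, liminf (fun n => f n x) atTop := ?_
    _ ≤ liminf (fun n => ∫⁻ x, f n x) atTop := lintegral_liminf_le hfm
    _ ≤ _ := liminf_le_liminf (Eventually.of_forall fun n =>
        lintegral_floor_le (sqrt_nonneg _) _ _ (by simp [hh, hq0]))
  refine lintegral_mono fun x => ?_
  by_cases hx : x ∈ G
  swap
  · simp [hx]
  rw [Set.indicator_of_mem hx]
  have hlim : Tendsto (fun n => f n x) atTop (𝓝 (gaussianPDF 0 v x)) := by
    refine ((ENNReal.continuous_ofReal.tendsto _).comp (hq x)).congr' ?_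
    filter_upwards [(tendsto_floor_sub_half_div_sqrt x).eventually_mem (hG.mem_nhds hx)] with n hn
    simp only [hf, hh, Function.comp, Set.indicator_of_mem hn, Pi.one_apply, one_mul]
    rw [ENNReal.ofReal_mul (sqrt_nonneg _)]
  exact hlim.liminf_eq.ge

theorem aemeasurable_ncard_lowerPoints {Ω : Type*} [MeasurableSpace Ω] {P : Measure Ω} {n : ℕ}
    {τ : Ω → Fin (n - 1) → Equiv.Perm (Fin n)}
    (hτ : HasLaw τ (uniformOn (decreasingFactorisations n)) P) :
    AEMeasurable (fun ω => (lowerPoints (τ ω)).ncard) P :=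
  (Measurable.of_discrete (f := fun σ : Fin (n - 1) → Equiv.Perm (Fin n) =>
    (lowerPoints σ).ncard)).comp_aemeasurable hτ.aemeasurable

/-- The law of the normalised number of distinct smaller elements, tested on an open set, is at
least the sum of the weights of the lattice points in that set. -/
theorem tsum_le_map_ncard_lowerPoints {Ω : Type*} [MeasurableSpace Ω] {P : Measure Ω}
    [IsProbabilityMeasure P] {n : ℕ} (hn : 2 ≤ n) {τ : Ω → Fin (n - 1) → Equiv.Perm (Fin n)}
    (hτ : HasLaw τ (uniformOn (decreasingFactorisations n)) P) {G : Set ℝ} (hG : IsOpen G) :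
    ∑' k : ℕ, (G.indicator 1 (((k : ℝ) - n / 2) / √(n : ℝ)) *
        ENNReal.ofReal (narayanaWeight n k) : ℝ≥0∞) ≤
      P.map (fun ω => (((lowerPoints (τ ω)).ncard : ℝ) - (n : ℝ) / 2) / √(n : ℝ)) G := by
  have hK := aemeasurable_ncard_lowerPoints hτ
  set φ : ℕ → ℝ := fun k => ((k : ℝ) - n / 2) / √(n : ℝ)
  have hφ : Measurable φ := .of_discrete
  have hmap : P.map (fun ω => (((lowerPoints (τ ω)).ncard : ℝ) - (n : ℝ) / 2) / √(n : ℝ)) =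
      (P.map fun ω => (lowerPoints (τ ω)).ncard).map φ :=
    (AEMeasurable.map_map_of_aemeasurable hφ.aemeasurable hK).symm
  rw [hmap, ← lintegral_indicator_one hG.measurableSet,
    lintegral_map (measurable_one.indicator hG.measurableSet) hφ, lintegral_countable']
  refine ENNReal.tsum_le_tsum fun k => mul_le_mul_right ?_ _
  rcases Nat.eq_zero_or_pos k with rfl | hk
  · simp [narayanaWeight]
  · rw [narayanaWeight, if_neg hk.ne', ← measureReal_ncard_lowerPoints_eq_choose hn hτ hk,
      Measure.map_apply_of_aemeasurable hK (measurableSet_singleton k), measureReal_def,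
      ENNReal.ofReal_toReal (measure_ne_top _ _)]
    rfl

end CycleFactorisation

theorem proposition1 {Ω : ℕ → Type*} [∀ n, MeasurableSpace (Ω n)]
    (P : ∀ n, Measure (Ω n)) [∀ n, IsProbabilityMeasure (P n)]
    (τ : ∀ n, Ω n → Fin (n - 1) → Equiv.Perm (Fin n))
    (hτ : ∀ n, 2 ≤ n →
      HasLaw (τ n) (uniformOn (CycleFactorisation.decreasingFactorisations n)) (P n)) :
    (∀ n, 2 ≤ n → ∀ᵐ ω ∂(P n), CycleFactorisation.upperPoints (τ n ω) = Set.Icc 2 n) ∧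
    (∀ n, 2 ≤ n → ∀ k, 1 ≤ k → k ≤ n - 1 →
      (P n).real {ω | (CycleFactorisation.lowerPoints (τ n ω)).ncard = k} =
        (n : ℝ) / ((n : ℝ) - 1) * ((n - 1).choose k : ℝ) * ((n - 1).choose (k - 1) : ℝ) /
          ((2 * n - 2).choose (n - 1) : ℝ)) ∧
    TendstoInDistribution
      (fun (n : ℕ) (ω : Ω n) =>
        (((CycleFactorisation.lowerPoints (τ n ω)).ncard : ℝ) - (n : ℝ) / 2) / Real.sqrt (n : ℝ))
      atTop (id : ℝ → ℝ) P (gaussianReal 0 (1 / 8)) := by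
  refine ⟨fun n hn => ?_, fun n hn k hk _ =>
    CycleFactorisation.measureReal_ncard_lowerPoints_eq_choose hn (hτ n hn) hk, ?_⟩
  · obtain ⟨d, rfl⟩ : ∃ d, n = d + 1 := ⟨n - 1, by omega⟩
    filter_upwards [CycleFactorisation.ae_mem_image_treeFactorisation d (hτ _ hn)] with ω hω
    obtain ⟨t, ht, heq⟩ := hω
    rw [← heq, CycleFactorisation.upperPoints_treeFactorisation ht]
  · have hmeas : ∀ n, AEMeasurable (fun ω : Ω n =>
        (((CycleFactorisation.lowerPoints (τ n ω)).ncard : ℝ) - (n : ℝ) / 2) /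
          Real.sqrt (n : ℝ)) (P n) := by
      intro n
      by_cases hn : 2 ≤ n
      · exact (Measurable.of_discrete (f := fun k : ℕ =>
          ((k : ℝ) - (n : ℝ) / 2) / Real.sqrt (n : ℝ))).comp_aemeasurable
          (CycleFactorisation.aemeasurable_ncard_lowerPoints (hτ n hn))
      · -- There is only the empty sequence of transpositions, so the function is constant.
        have : IsEmpty (Fin (n - 1)) := by
          rw [show n - 1 = 0 by omega]
          infer_instance
        have hconst : ∀ ω, τ n ω = fun i => isEmptyElim i := fun ω => Subsingleton.elim _ _
        simp only [hconst]
        exact aemeasurable_const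
    refine ⟨hmeas, aemeasurable_id, tendsto_of_forall_isOpen_le_liminf' fun G hG => ?_⟩
    simp only [ProbabilityMeasure.coe_mk, Measure.map_id]
    refine (CycleFactorisation.gaussianReal_le_liminf (by norm_num)
      (q := CycleFactorisation.narayanaWeight) (by simp [CycleFactorisation.narayanaWeight])
      CycleFactorisation.tendsto_sqrt_mul_narayanaWeight hG).trans (liminf_le_liminf ?_)
    filter_upwards [eventually_ge_atTop 2] with n hn
    exact CycleFactorisation.tsum_le_map_ncard_lowerPoints hn (hτ n hn) hG
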